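/- Let $\alpha,\eta,\theta,R$ be real $N\times N$ matrices with $\alpha=\alpha^{\mathrm T}>0$, $\eta=\eta^{\mathrm T}\ge 0$, $\theta^{\mathrm T}=-\theta$, $R=R^{\mathrm T}\ge 0$ and $N_R:=\operatorname{rank}R>0$, and consider the gyroscopic-dissipative system $\alpha\ddot Q+(2\theta+\beta R)\dot Q+\eta Q=0$ with loss parameter $\beta\ge 0$. Put $K_p=\sqrt{\alpha}^{\,-1}$, $K_q=\sqrt{\eta}$, $\Phi=K_qK_p^{\mathrm T}$ and let \[ A(\beta)=\Omega-\mathrm i\beta B,\qquad \Omega=\begin{bmatrix}-2\mathrm i K_p\theta K_p^{\mathrm T} & -\mathrm i\Phi^{\mathrm T}\\ \mathrm i\Phi & 0\end{bmatrix},\qquad B=\begin{bmatrix}K_pRK_p^{\mathrm T}&0\\0&0\end{bmatrix} \] be the system operator on $\mathbb C^{2N}$. The generic condition for the system says that the $N_R$ eigenvalues, counted with multiplicity, of $B_2=P_BBP_B|_{\operatorname{Ran}B}:\operatorname{Ran}B\to\operatorname{Ran}B$ are pairwise distinct, where $P_B$ is the orthogonal projection onto $\operatorname{Ran}B$ (equivalently,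 the nonzero eigenvalues of $\alpha^{-1}R$ are simple). If $\eta>0$, the dual system is the one obtained by interchanging $\alpha$ and $\eta$. Assume the duality condition $\eta>0$ and that the generic condition holds both for the system and for its dual. Then the eigenvalues of $A(\beta)$, counted with multiplicity, can be enumerated for all sufficiently large $\beta$ as $\zeta_1(\beta),\dots,\zeta_{2N}(\beta)$ in such a way that, as $\beta\to\infty$, \begin{align*} &|\zeta_j(\beta)|\to\infty, && 1\le j\le N_R \quad\text{(high-loss)},\\ &\zeta_j(\beta)\to 0, && N_R+1\le j\le 2N_R \quad\text{(low-loss/low-Q)},\\ &\zeta_j(\beta)\to\rho_j \text{ for some real } \rho_j\neq 0, && 2N_R+1\le j\le 2N \quad\text{(low-loss/high-Q)}, \end{align*} and every such enumeration has the following properties: \begin{enumerate} \item for all sufficiently large $\beta$, $\operatorname{Re}\zeta_j(\beta)=0$ for $1\le j\le N_R$; \item for all sufficiently large $\beta$, $\operatorname{Re}\zeta_j(\beta)\neq 0$ for $2N_R+1\le j\le 2N$; \item $\lim_{\beta\to\infty}\operatorname{Re}\zeta_j(\beta)=0$ for $N_R+1\le j\le 2N_R$; \item moreover, for all sufficiently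 large $\beta$, $\operatorname{Re}\zeta_j(\beta)=0$ for $N_R+1\le j\le 2N_R$. \end{enumerate} -/

import Mathlib

open Matrix Filter Topology
open scoped MatrixOrder

noncomputable section

/-- The data of the system `α Q'' + (2 θ + β R) Q' + η Q = 0` with `N` degrees of freedom
(the loss parameter `β` is kept as a variable). -/
structure LagrangianSystem (N : ℕ) where
  α : Matrix (Fin N) (Fin N) ℝ
  θ : Matrix (Fin N) (Fin N) ℝ
  η : Matrix (Fin N) (Fin N) ℝ
  R : Matrix (Fin N) (Fin N) ℝ
  posDef_α : α.PosDef
  skew_θ : θᵀ = -θ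
  posSemidef_η : η.PosSemidef
  posSemidef_R : R.PosSemidef
  rank_R_pos : 0 < R.rank

namespace LagrangianSystem

variable {N : ℕ}

/-- The dual system, obtained by interchanging `α` and `η`. It exists under the duality
condition `η > 0`. -/
def dual (S : LagrangianSystem N) (hη : S.η.PosDef) : LagrangianSystem N where
  α := S.η
  θ := S.θ
  η := S.α
  R := S.R
  posDef_α := hη
  skew_θ := S.skew_θ
  posSemidef_η := S.posDef_α.posSemidef
  posSemidef_R := S.posSemidef_R
  rank_R_pos := S.rank_R_pos

/-- The rank `N_R` of the loss matrix. -/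
def NR (S : LagrangianSystem N) : ℕ := S.R.rank

/-- `K_p = (√α)⁻¹`, with the positive definite square root. -/
def Kp (S : LagrangianSystem N) : Matrix (Fin N) (Fin N) ℝ := (CFC.sqrt S.α)⁻¹

/-- `K_q = √η`, with the positive semidefinite square root. -/
def Kq (S : LagrangianSystem N) : Matrix (Fin N) (Fin N) ℝ := CFC.sqrt S.η

/-- `Φ = K_q K_pᵀ`. -/
def Phi (S : LagrangianSystem N) : Matrix (Fin N) (Fin N) ℝ := S.Kq * S.Kpᵀ

/-- The frequency operator `Ω`, in the block form
`[[-2 i K_p θ K_pᵀ, -i Φᵀ], [i Φ, 0]]`. -/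
def Omega (S : LagrangianSystem N) : Matrix (Fin N ⊕ Fin N) (Fin N ⊕ Fin N) ℂ :=
  Matrix.fromBlocks
    ((-(2 * Complex.I)) • (S.Kp * S.θ * S.Kpᵀ).map Complex.ofReal)
    ((-Complex.I) • (S.Phiᵀ).map Complex.ofReal)
    (Complex.I • S.Phi.map Complex.ofReal)
    0

/-- The dissipation operator `B`, in the block form `[[K_p R K_pᵀ, 0], [0, 0]]`. -/
def B (S : LagrangianSystem N) : Matrix (Fin N ⊕ Fin N) (Fin N ⊕ Fin N) ℂ :=
  Matrix.fromBlocks ((S.Kp * S.R * S.Kpᵀ).map Complex.ofReal) 0 0 0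

/-- The system operator `A(β) = Ω - i β B`. -/
def A (S : LagrangianSystem N) (β : ℝ) : Matrix (Fin N ⊕ Fin N) (Fin N ⊕ Fin N) ℂ :=
  S.Omega - (Complex.I * (β : ℂ)) • S.B

/-- The operator `B` on the Hilbert space `ℂ^{2N}` with its standard inner product. -/
def Bop (S : LagrangianSystem N) :
    EuclideanSpace ℂ (Fin N ⊕ Fin N) →ₗ[ℂ] EuclideanSpace ℂ (Fin N ⊕ Fin N) :=
  Matrix.toEuclideanLin S.B

/-- The loss subspace `H_B = Ran B`. -/
def HB (S : LagrangianSystem N) : Submodule ℂ (EuclideanSpace ℂ (Fin N ⊕ Fin N)) :=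
  LinearMap.range S.Bop

/-- The compression `B₂ = P_B B P_B |_{H_B} : H_B → H_B` of `B` to the loss subspace, where
`P_B` is the orthogonal projection onto `H_B`. -/
def B2 (S : LagrangianSystem N) : S.HB →ₗ[ℂ] S.HB :=
  (S.HB.orthogonalProjectionOnto : EuclideanSpace ℂ (Fin N ⊕ Fin N) →ₗ[ℂ] S.HB) ∘ₗ
    S.Bop ∘ₗ S.HB.subtype

/-- The generic condition: the eigenvalues `b_1, …, b_{N_R}` of `B₂`, listed with
multiplicity, are pairwise distinct. -/
def Generic (S : LagrangianSystem N) : Prop := S.B2.charpoly.roots.Nodup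

/-- `ζ_1(β), …, ζ_{2N}(β)` is an enumeration of the eigenvalues of `A(β)`, counted with
multiplicity, for all large `β`, indexed by its behaviour as `β → ∞`: high-loss first, then
low-loss/low-Q, then low-loss/high-Q (whose limits are nonzero limiting frequencies `ρ`).
Indices start at `0`, so `1 ≤ j ≤ N_R` becomes `j < N_R`, and so on. -/
structure IsModalEnumeration (S : LagrangianSystem N) (ζ : Fin (2 * N) → ℝ → ℂ) : Prop where
  eigenvalues : ∀ᶠ β : ℝ in atTop,
    (S.A β).charpoly.roots = (Finset.univ : Finset (Fin (2 * N))).val.map (fun j => ζ j β)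
  high_loss : ∀ j : Fin (2 * N), (j : ℕ) < S.NR → Tendsto (fun β => ‖ζ j β‖) atTop atTop
  low_loss_low_Q : ∀ j : Fin (2 * N), S.NR ≤ (j : ℕ) → (j : ℕ) < 2 * S.NR →
    Tendsto (ζ j) atTop (𝓝 0)
  low_loss_high_Q : ∀ j : Fin (2 * N), 2 * S.NR ≤ (j : ℕ) →
    ∃ ρ : ℝ, ρ ≠ 0 ∧ Tendsto (ζ j) atTop (𝓝 (ρ : ℂ))

end LagrangianSystem

end

/-!
The characteristic polynomial of `A(β)` is, up to normalization, the determinant of the quadratic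
pencil `z² α + i z (2θ + βR) - η`. In coordinates in which `α = 1` and `R` is diagonal, dividing it
by `β ^ N_R` leaves, as `β → ∞`, a multiple of `z ^ N_R` times the determinant of the pencil
compressed to `ker R`. The compressed system is lossless and has positive stiffness, so its
linearization is Hermitian and invertible and its frequencies are real and nonzero. Continuity of
the roots of polynomials yields the three groups of modes.

Overdamping is a counting argument. On the imaginary axis, `z = i t`, the pencil is the real matrix
`t² α + t (2θ + βR) + η` up to sign. After the substitution `t = β s` its determinant tends, up to a
power of `β`, to `∏ s (s + d i)`, the `d i` being the eigenvalues of the loss matrix; the generic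
condition makes the nonzero roots of this limit simple, so by the intermediate value theorem they
persist as real roots for large `β`. This produces `N_R` distinct purely imaginary eigenvalues that
tend to infinity, hence all high-loss ones. The substitution `t ↦ 1 / t` interchanges `α` and `η`,
so the same argument for the dual system accounts for the low-loss/low-Q modes.
-/

noncomputable section

section ContinuityOfRoots

open Polynomial

variable {α 𝕜 : Type*} {l : Filter α}

lemma tendsto_coeff_of_tendsto_eval [Field 𝕜] [Infinite 𝕜] [TopologicalSpace 𝕜]
    [IsTopologicalSemiring 𝕜] {n : ℕ} {p : α → 𝕜[X]} {q : 𝕜[X]}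
    (hp : ∀ x, (p x).natDegree ≤ n) (hq : q.natDegree ≤ n)
    (h : ∀ᶠ z in cofinite, Tendsto (fun x => (p x).eval z) l (𝓝 (q.eval z))) (k : ℕ) :
    Tendsto (fun x => (p x).coeff k) l (𝓝 (q.coeff k)) := by
  classical
  obtain ⟨t, ht, ht'⟩ :=
    (frequently_cofinite_iff_infinite.mp h.frequently).exists_subset_card_eq (n + 1)
  have coeff_eq (r : 𝕜[X]) (hr : r.natDegree ≤ n) :
      r.coeff k = ∑ z ∈ t, r.eval z * (Lagrange.basis t id z).coeff k := by
    have hdeg : r.degree < t.card := by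
      rw [ht']
      exact degree_le_natDegree.trans_lt (by exact_mod_cast Nat.lt_succ_of_le hr)
    conv_lhs => rw [Lagrange.eq_interpolate Function.injective_id.injOn hdeg]
    simp [Lagrange.interpolate_apply, finsetSum_coeff]
  simp only [coeff_eq _ (hp _), coeff_eq _ hq]
  exact tendsto_finsetSum _ fun z hz => (ht hz).mul_const _

variable [NormedField 𝕜]

lemma tendstoUniformlyOn_eval_of_tendsto_coeff {n : ℕ} {p : α → 𝕜[X]} {q : 𝕜[X]}
    (hp : ∀ x, (p x).natDegree ≤ n) (hq : q.natDegree ≤ n)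
    (h : ∀ k, Tendsto (fun x => (p x).coeff k) l (𝓝 (q.coeff k))) {B : Set 𝕜}
    (hB : Bornology.IsBounded B) :
    TendstoUniformlyOn (fun x z => (p x).eval z) (fun z => q.eval z) l B := by
  obtain ⟨M, hM⟩ := hB.exists_norm_le
  have hsum : Tendsto (fun x => ∑ k ∈ Finset.range (n + 1), ‖q.coeff k - (p x).coeff k‖ * M ^ k) l
      (𝓝 0) := by
    simpa using tendsto_finsetSum (Finset.range (n + 1)) fun k _ =>
      ((tendsto_const_nhds (x := q.coeff k)).sub (h k)).norm.mul_const (M ^ k)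
  refine Metric.tendstoUniformlyOn_iff.mpr fun ε hε => ?_
  filter_upwards [hsum.eventually_lt_const hε] with x hx z hz
  calc dist (q.eval z) ((p x).eval z) = ‖(q - p x).eval z‖ := by rw [dist_eq_norm, eval_sub]
    _ = ‖∑ k ∈ Finset.range (n + 1), (q.coeff k - (p x).coeff k) * z ^ k‖ := by
      have hdeg : (q - p x).natDegree < n + 1 :=
        Nat.lt_succ_of_le (by simpa using natDegree_sub_le_of_le hq (hp x))
      rw [eval_eq_sum_range' hdeg]
      simp only [coeff_sub]
    _ ≤ ∑ k ∈ Finset.range (n + 1), ‖q.coeff k - (p x).coeff k‖ * M ^ k := by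
      refine norm_sum_le_of_le _ fun k _ => ?_
      rw [norm_mul, norm_pow]
      gcongr
      exact hM z hz
    _ < ε := hx

variable {s : α → Multiset 𝕜} {c : α → 𝕜} {K : 𝕜}

lemma natDegree_C_mul_prod_X_sub_C_le (a : 𝕜) (m : Multiset 𝕜) :
    (C a * (m.map fun b => X - C b).prod).natDegree ≤ m.card :=
  (natDegree_C_mul_le _ _).trans (natDegree_multiset_prod_X_sub_C_eq_card m).le

lemma eval_C_mul_prod_X_sub_C (a : 𝕜) (m : Multiset 𝕜) (z : 𝕜) :
    (C a * (m.map fun b => X - C b).prod).eval z = a * (m.map fun b => z - b).prod := by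
  simp [eval_multiset_prod, Multiset.map_map]

lemma tendstoUniformlyOn_mul_prod_sub [Infinite 𝕜] {n : ℕ} (hs : ∀ x, (s x).card = n)
    {ρ : Multiset 𝕜} (hρ : ρ.card ≤ n)
    (h : ∀ᶠ z in cofinite, Tendsto (fun x => c x * ((s x).map fun a => z - a).prod) l
      (𝓝 (K * (ρ.map fun a => z - a).prod))) {B : Set 𝕜} (hB : Bornology.IsBounded B) :
    TendstoUniformlyOn (fun x z => c x * ((s x).map fun a => z - a).prod)
      (fun z => K * (ρ.map fun a => z - a).prod) l B := by
  simp only [← eval_C_mul_prod_X_sub_C] at h ⊢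
  have hdeg (x : α) : (C (c x) * ((s x).map fun b => X - C b).prod).natDegree ≤ n :=
    (natDegree_C_mul_prod_X_sub_C_le _ _).trans (hs x).le
  have hdeg' := (natDegree_C_mul_prod_X_sub_C_le K ρ).trans hρ
  exact tendstoUniformlyOn_eval_of_tendsto_coeff hdeg hdeg'
    (tendsto_coeff_of_tendsto_eval hdeg hdeg' h) hB

lemma norm_mul_prod_sub_le {m : Multiset 𝕜} {z w : 𝕜} {C : ℝ}
    (h : ∀ a ∈ m, ‖w - a‖ ≤ C * ‖z - a‖) (b : 𝕜) :
    ‖b * (m.map fun a => w - a).prod‖ ≤ C ^ m.card * ‖b * (m.map fun a => z - a).prod‖ := by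
  have norm_prod (u : 𝕜) :
      ‖(m.map fun a => u - a).prod‖ = (m.map fun a => ‖u - a‖).prod := by
    simpa [Multiset.map_map, Function.comp_def] using
      map_multiset_prod (normHom : 𝕜 →*₀ ℝ) (m.map fun a => u - a)
  have hC : (m.map fun a => C * ‖z - a‖).prod = C ^ m.card * (m.map fun a => ‖z - a‖).prod := by
    rw [Multiset.prod_map_mul, Multiset.map_const', Multiset.prod_replicate]
  rw [norm_mul, norm_mul, norm_prod, norm_prod, mul_left_comm, ← hC]
  gcongr
  exact Multiset.prod_map_le_prod_map₀ _ _ (fun a _ => norm_nonneg _) h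

-- If no root is within `ε` of `z`, moving from `z` to `w` multiplies each factor by a bounded
-- amount, so the product cannot be small at `z` and large at `w`.
lemma eventually_exists_mem_dist_lt {n : ℕ} (hs : ∀ x, (s x).card = n) {z w : 𝕜}
    (hz : Tendsto (fun x => c x * ((s x).map fun a => z - a).prod) l (𝓝 0))
    (hw : Tendsto (fun x => c x * ((s x).map fun a => w - a).prod) l (𝓝 K)) (hK : K ≠ 0)
    {ε : ℝ} (hε : 0 < ε) : ∀ᶠ x in l, ∃ a ∈ s x, dist a z < ε := by
  have hlt : ∀ᶠ x in l, (‖w - z‖ / ε + 1) ^ n * ‖c x * ((s x).map fun a => z - a).prod‖ <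
      ‖c x * ((s x).map fun a => w - a).prod‖ := by
    refine Tendsto.eventually_lt (hz.norm.const_mul _) hw.norm ?_
    simpa using hK
  filter_upwards [hlt] with x hx
  by_contra! hfar
  refine hx.not_ge (hs x ▸ norm_mul_prod_sub_le (fun a ha => ?_) (c x))
  have hza : ε ≤ ‖z - a‖ := by simpa [dist_eq_norm, norm_sub_rev] using hfar a ha
  calc ‖w - a‖ ≤ ‖w - z‖ + ‖z - a‖ := norm_sub_le_norm_sub_add_norm_sub _ _ _
    _ ≤ ‖w - z‖ / ε * ‖z - a‖ + ‖z - a‖ := by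
      gcongr
      rw [div_mul_eq_mul_div, le_div_iff₀ hε]
      gcongr
    _ = (‖w - z‖ / ε + 1) * ‖z - a‖ := by ring

lemma exists_tendsto_of_eventually_exists_mem {Y : Type*} [PseudoMetricSpace Y]
    {s : α → Multiset Y} (hs : ∀ x, s x ≠ 0) {z : Y}
    (h : ∀ ε > 0, ∀ᶠ x in l, ∃ a ∈ s x, dist a z < ε) :
    ∃ r : α → Y, (∀ x, r x ∈ s x) ∧ Tendsto r l (𝓝 z) := by
  classical
  have exists_nearest (x : α) : ∃ r ∈ s x, ∀ a ∈ s x, dist r z ≤ dist a z := by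
    simpa using (s x).toFinset.exists_min_image (dist · z) (by simpa using hs x)
  choose r hr hmin using exists_nearest
  refine ⟨r, hr, Metric.tendsto_nhds.mpr fun ε hε => ?_⟩
  filter_upwards [h ε hε] with x ⟨a, ha, hlt⟩
  exact (hmin x a ha).trans_lt hlt

lemma eventually_forall_mem_notMem_of_tendsto_const [Infinite 𝕜] {n : ℕ}
    (hs : ∀ x, (s x).card = n) (hK : K ≠ 0)
    (h : ∀ᶠ z in cofinite, Tendsto (fun x => c x * ((s x).map fun a => z - a).prod) l (𝓝 K))
    {B : Set 𝕜} (hB : Bornology.IsBounded B) : ∀ᶠ x in l, ∀ a ∈ s x, a ∉ B := by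
  have hunif := tendstoUniformlyOn_mul_prod_sub (ρ := 0) (K := K) hs (by simp) (by simpa using h) hB
  filter_upwards [Metric.tendstoUniformlyOn_iff.mp hunif ‖K‖ (norm_pos_iff.mpr hK)]
    with x hx a ha haB
  have hprod : ((s x).map fun b => a - b).prod = 0 :=
    Multiset.prod_eq_zero (Multiset.mem_map.mpr ⟨a, ha, sub_self a⟩)
  simpa [hprod] using hx a haB

lemma exists_tendsto_root [Infinite 𝕜] {n : ℕ} (hs : ∀ x, (s x).card = n) (hK : K ≠ 0)
    {ρ : Multiset 𝕜} (hρ : ρ.card ≤ n)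
    (h : ∀ᶠ z in cofinite, Tendsto (fun x => c x * ((s x).map fun a => z - a).prod) l
      (𝓝 (K * (ρ.map fun a => z - a).prod))) {z : 𝕜} (hz : z ∈ ρ) :
    ∃ r : α → 𝕜, (∀ x, r x ∈ s x) ∧ Tendsto r l (𝓝 z) := by
  classical
  have hs0 (x : α) : s x ≠ 0 := by
    refine Multiset.card_pos.mp ?_
    exact hs x ▸ (Multiset.card_pos_iff_exists_mem.mpr ⟨z, hz⟩).trans_le hρ
  have hlim := (tendstoUniformlyOn_mul_prod_sub hs hρ h Bornology.isBounded_singleton).tendsto_at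
    (Set.mem_singleton z)
  have hprod : (ρ.map fun a => z - a).prod = 0 :=
    Multiset.prod_eq_zero (Multiset.mem_map.mpr ⟨z, hz, sub_self z⟩)
  rw [hprod, mul_zero] at hlim
  obtain ⟨w, hw, hwρ⟩ := (h.and ρ.toFinset.eventually_cofinite_notMem).exists
  have hKw : K * (ρ.map fun a => w - a).prod ≠ 0 := by
    refine mul_ne_zero hK (Multiset.prod_ne_zero fun h0 => ?_)
    obtain ⟨a, ha, hwa⟩ := Multiset.mem_map.mp h0
    exact hwρ (by simpa [sub_eq_zero.mp hwa] using ha)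
  exact exists_tendsto_of_eventually_exists_mem hs0 fun ε hε =>
    eventually_exists_mem_dist_lt hs hlim hw hKw hε

lemma tendsto_mul_prod_sub_erase [DecidableEq 𝕜] {r : α → 𝕜} (hr : ∀ x, r x ∈ s x) {a z b : 𝕜}
    (hra : Tendsto r l (𝓝 a)) (hz : z ≠ a)
    (h : Tendsto (fun x => c x * ((s x).map fun a => z - a).prod) l (𝓝 ((z - a) * b))) :
    Tendsto (fun x => c x * (((s x).erase (r x)).map fun a => z - a).prod) l (𝓝 b) := by
  have hdiv := h.div (hra.const_sub z) (sub_ne_zero.mpr hz)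
  rw [mul_div_cancel_left₀ _ (sub_ne_zero.mpr hz)] at hdiv
  refine hdiv.congr' ?_
  filter_upwards [hra.eventually_ne hz.symm] with x hx
  rw [Pi.div_apply, div_eq_iff (sub_ne_zero.mpr hx.symm), mul_assoc, mul_comm _ (z - r x),
    Multiset.prod_map_erase (f := fun a => z - a) (hr x)]

lemma val_map_eq_cons_map_erase {ι Y : Type*} [DecidableEq ι] {I : Finset ι} {j : ι} (hj : j ∈ I)
    {f g : ι → Y} (h : ∀ i, i ≠ j → f i = g i) :
    I.val.map f = f j ::ₘ (I.erase j).val.map g := by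
  conv_lhs => rw [← Multiset.cons_erase (Finset.mem_val.mpr hj), ← Finset.erase_val]
  rw [Multiset.map_cons, Multiset.map_congr rfl fun i hi => h i (Finset.ne_of_mem_erase hi)]

lemma exists_eq_val_map_of_card_eq {ι Y : Type*} [Nonempty Y] {I : Finset ι} {m : Multiset Y}
    (h : m.card = I.card) : ∃ f : ι → Y, m = I.val.map f := by
  classical
  induction I using Finset.induction_on generalizing m with
  | empty => exact ⟨fun _ => Classical.arbitrary Y, by simpa using h⟩
  | insert i I hi ih =>
    rw [Finset.card_insert_of_notMem hi] at h
    obtain ⟨a, m, rfl, hm⟩ := Multiset.card_eq_succ_iff.mp h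
    obtain ⟨f, rfl⟩ := ih hm
    refine ⟨Function.update f i a, ?_⟩
    rw [val_map_eq_cons_map_erase (Finset.mem_insert_self i I)
      fun k hk => Function.update_of_ne hk a f, Finset.erase_insert hi, Function.update_self]

lemma exists_enumeration_tendsto_cobounded [Infinite 𝕜] {ι : Type*} {I : Finset ι}
    (hs : ∀ x, (s x).card = I.card) (hK : K ≠ 0)
    (h : ∀ᶠ z in cofinite, Tendsto (fun x => c x * ((s x).map fun a => z - a).prod) l (𝓝 K)) :
    ∃ ζ : ι → α → 𝕜, (∀ x, s x = I.val.map fun i => ζ i x) ∧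
      ∀ i ∈ I, Tendsto (ζ i) l (Bornology.cobounded 𝕜) := by
  choose ξ hξ using fun x => exists_eq_val_map_of_card_eq (hs x)
  refine ⟨fun i x => ξ x i, hξ, fun i hi B hB => ?_⟩
  have hroots := eventually_forall_mem_notMem_of_tendsto_const hs hK h
    (Bornology.isBounded_compl_iff.mpr hB)
  refine hroots.mono fun x hx => not_not.mp (hx (ξ x i) ?_)
  rw [hξ x]
  exact Multiset.mem_map_of_mem _ hi

-- The convergent roots are split off one at a time; once the limit is constant, the remaining
-- roots all escape to infinity.
lemma exists_enumeration_of_tendsto [Infinite 𝕜] {ι : Type*} {I J : Finset ι} (hJ : J ⊆ I)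
    (hs : ∀ x, (s x).card = I.card) (ρ : ι → 𝕜) (hK : K ≠ 0)
    (h : ∀ᶠ z in cofinite, Tendsto (fun x => c x * ((s x).map fun a => z - a).prod) l
      (𝓝 (K * ∏ j ∈ J, (z - ρ j)))) :
    ∃ ζ : ι → α → 𝕜, (∀ x, s x = I.val.map fun i => ζ i x) ∧
      (∀ j ∈ J, Tendsto (ζ j) l (𝓝 (ρ j))) ∧
      ∀ i ∈ I, i ∉ J → Tendsto (ζ i) l (Bornology.cobounded 𝕜) := by
  classical
  induction J using Finset.induction_on generalizing I s with
  | empty =>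
    obtain ⟨ζ, hζ, hζI⟩ := exists_enumeration_tendsto_cobounded hs hK (by simpa using h)
    exact ⟨ζ, hζ, by simp, fun i hi _ => hζI i hi⟩
  | insert j J hj ih =>
    have hjI : j ∈ I := hJ (Finset.mem_insert_self j J)
    obtain ⟨r, hr, hrt⟩ := exists_tendsto_root (ρ := (insert j J).val.map ρ) hs hK
      ((Multiset.card_map _ _).trans_le (Finset.card_le_card hJ))
      (by simpa only [Multiset.map_map, Function.comp_def, Finset.prod_eq_multiset_prod] using h)
      (Multiset.mem_map_of_mem ρ (Finset.mem_insert_self j J))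
    have hdeflated : ∀ᶠ z in cofinite,
        Tendsto (fun x => c x * (((s x).erase (r x)).map fun a => z - a).prod) l
          (𝓝 (K * ∏ i ∈ J, (z - ρ i))) := by
      filter_upwards [h, (Set.finite_singleton (ρ j)).eventually_cofinite_notMem] with z hz hzj
      rw [Finset.prod_insert hj, mul_left_comm] at hz
      exact tendsto_mul_prod_sub_erase hr hrt hzj hz
    obtain ⟨ζ, hζ, hζJ, hζI⟩ := ih
      (Finset.subset_erase.mpr ⟨(Finset.subset_insert j J).trans hJ, hj⟩)
      (fun x => by rw [Multiset.card_erase_of_mem (hr x), hs x, Finset.card_erase_of_mem hjI]; rfl)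
      hdeflated
    have hne (i : ι) (hi : i ≠ j) : Function.update ζ j r i = ζ i := Function.update_of_ne hi r ζ
    refine ⟨Function.update ζ j r, fun x => ?_, fun i hi => ?_, fun i hiI hi => ?_⟩
    · rw [val_map_eq_cons_map_erase hjI fun i hi => congrFun (hne i hi) x, ← hζ,
        Function.update_self, Multiset.cons_erase (hr x)]
    · obtain rfl | hiJ := Finset.mem_insert.mp hi
      · rwa [Function.update_self]
      · rw [hne i (ne_of_mem_of_not_mem hiJ hj)]
        exact hζJ i hiJ
    · rw [Finset.mem_insert, not_or] at hi
      rw [hne i hi.1]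
      exact hζI i (Finset.mem_erase.mpr ⟨hi.1, hiI⟩) hi.2

end ContinuityOfRoots

section Zeros

variable {α : Type*} {l : Filter α}

lemma eventually_exists_zero_mem_of_tendsto {f : α → ℝ → ℝ} {g k : ℝ → ℝ} {a : ℝ}
    (hf : ∀ x, Continuous (f x)) (hfg : ∀ t, Tendsto (fun x => f x t) l (𝓝 (g t)))
    (hgk : ∀ t, g t = (t - a) * k t) (hk : ContinuousAt k a) (hka : k a ≠ 0) {U : Set ℝ}
    (hU : U ∈ 𝓝 a) : ∀ᶠ x in l, ∃ y ∈ U, f x y = 0 := by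
  have hpos : ∀ᶠ t in 𝓝 a, 0 < k a * k t :=
    (hk.tendsto.const_mul (k a)).eventually_const_lt (mul_self_pos.mpr hka)
  obtain ⟨δ, hδ, hball⟩ :=
    Metric.nhds_basis_closedBall.mem_iff.mp (Filter.inter_mem hU hpos)
  rw [Real.closedBall_eq_Icc] at hball
  have hle : a - δ ≤ a + δ := by linarith
  have hsign : g (a - δ) * g (a + δ) < 0 := by
    have h₁ : 0 < k a * k (a - δ) := (hball (Set.left_mem_Icc.mpr hle)).2
    have h₂ : 0 < k a * k (a + δ) := (hball (Set.right_mem_Icc.mpr hle)).2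
    have hkk : 0 < k (a - δ) * k (a + δ) := by
      refine pos_of_mul_pos_right (a := k a * k a) ?_ (mul_self_nonneg _)
      nlinarith [mul_pos h₁ h₂]
    rw [hgk, hgk]
    nlinarith [mul_pos (mul_pos hδ hδ) hkk]
  filter_upwards [((hfg _).mul (hfg _)).eventually_lt_const hsign] with x hx
  have hzero : (0 : ℝ) ∈ Set.uIcc (f x (a - δ)) (f x (a + δ)) := by
    rcases mul_neg_iff.mp hx with h | h
    · exact Set.mem_uIcc.mpr (Or.inr ⟨h.2.le, h.1.le⟩)
    · exact Set.mem_uIcc.mpr (Or.inl ⟨h.1.le, h.2.le⟩)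
  obtain ⟨y, hy, hfy⟩ := intermediate_value_uIcc (hf x).continuousOn hzero
  rw [Set.uIcc_of_le hle] at hy
  exact ⟨y, (hball hy).1, hfy⟩

lemma eventually_exists_injective_mem_of_forall_mem_nhds {ι Y : Type*} [Finite ι]
    [TopologicalSpace Y] [T2Space Y] {P : α → Y → Prop} {a : ι → Y} (ha : Function.Injective a)
    (h : ∀ i, ∀ U ∈ 𝓝 (a i), ∀ᶠ x in l, ∃ y ∈ U, P x y) {V : ι → Set Y}
    (hV : ∀ i, V i ∈ 𝓝 (a i)) :
    ∀ᶠ x in l, ∃ y : ι → Y, Function.Injective y ∧ ∀ i, y i ∈ V i ∧ P x (y i) := by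
  obtain ⟨U, hU, hdisj⟩ := (Set.finite_range a).t2_separation
  have hUV (i : ι) : U (a i) ∩ V i ∈ 𝓝 (a i) :=
    Filter.inter_mem ((hU (a i)).2.mem_nhds (hU (a i)).1) (hV i)
  filter_upwards [eventually_all.mpr fun i => h i _ (hUV i)] with x hx
  choose y hyUV hPy using hx
  refine ⟨y, fun i j hij => ?_, fun i => ⟨(hyUV i).2, hPy i⟩⟩
  by_contra hne
  exact Set.disjoint_left.mp (hdisj ⟨i, rfl⟩ ⟨j, rfl⟩ (ha.ne hne)) (hyUV i).1 (hij ▸ (hyUV j).1)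

end Zeros

lemma mem_range_of_injective_of_card_le {ι κ Y : Type*} [Fintype ι] {w : ι → Y} {z : κ → Y}
    {J : Finset κ} (hw : Function.Injective w) (hJ : J.card ≤ Fintype.card ι)
    (h : ∀ i, ∃ j ∈ J, z j = w i) {j : κ} (hj : j ∈ J) : z j ∈ Set.range w := by
  choose f hfJ hf using h
  have hf_inj : Function.Injective f := fun a b hab => hw (by rw [← hf, ← hf, hab])
  obtain ⟨i, -, rfl⟩ := Finset.surjOn_of_injOn_of_card_le (s := Finset.univ) f
    (fun i _ => hfJ i) hf_inj.injOn hJ hj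
  exact ⟨i, (hf i).symm⟩

lemma exists_fin_family_prod_filter_eq {γ Y M : Type*} [Fintype γ] [CommMonoid M] {n m : ℕ}
    (h : n = m + (m + Fintype.card γ)) (a : Y) (ρ : γ → Y) :
    ∃ r : Fin n → Y, (∀ j : Fin n, (j : ℕ) < 2 * m → r j = a) ∧
      (∀ j : Fin n, 2 * m ≤ (j : ℕ) → r j ∈ Set.range ρ) ∧
      ∀ g : Y → M, ∏ j ∈ Finset.univ.filter (fun j : Fin n => m ≤ (j : ℕ)), g (r j) =
        g a ^ m * ∏ c, g (ρ c) := by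
  subst h
  let e := Fintype.equivFin γ
  refine ⟨Fin.append (fun _ => a) (Fin.append (fun _ => a) (ρ ∘ e.symm)),
    fun j => ?_, fun j => ?_, fun g => ?_⟩
  · refine Fin.addCases (fun i _ => by simp) (fun i => Fin.addCases (fun i _ => by simp)
      (fun i hi => absurd hi ?_) i) j
    simp only [Fin.val_natAdd]
    omega
  · refine Fin.addCases (fun i hi => absurd hi ?_) (fun i => Fin.addCases
      (fun i hi => absurd hi ?_) (fun i _ => by simp) i) j
    · simp only [Fin.val_castAdd]
      omega
    · simp only [Fin.val_natAdd, Fin.val_castAdd]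
      omega
  · simp [Finset.prod_filter, Fin.prod_univ_add, fun i : Fin m => i.is_lt.not_ge,
      e.symm.prod_comp fun c => g (ρ c)]

lemma exists_forall_eventually_norm_le {α κ E : Type*} [Finite κ] [SeminormedAddCommGroup E]
    {l : Filter α} {f : κ → α → E} {p : κ → Prop}
    (hf : ∀ j, p j → ∃ a, Tendsto (f j) l (𝓝 a)) :
    ∃ M, ∀ j, p j → ∀ᶠ x in l, ‖f j x‖ ≤ M := by
  have h (j : κ) : ∀ᶠ M : ℝ in atTop, p j → ∀ᶠ x in l, ‖f j x‖ ≤ M := by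
    by_cases hj : p j
    · obtain ⟨a, ha⟩ := hf j hj
      filter_upwards [eventually_gt_atTop ‖a‖] with M hM _
      exact ha.norm.eventually_le_const hM
    · exact Eventually.of_forall fun M hp => absurd hp hj
  exact (eventually_all.mpr h).exists

/-- The quadratic matrix pencil `t ↦ t² M + t C + K` with mass, damping and stiffness coefficients
`M`, `C` and `K`. -/
def quadraticPencil {n R : Type*} [CommSemiring R] (M C K : Matrix n n R) (t : R) : Matrix n n R :=
  t ^ 2 • M + t • C + K

section QuadraticPencil

variable {n R S : Type*} [CommSemiring R] [CommSemiring S]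

lemma mul_quadraticPencil_mul [Fintype n] (V M C K W : Matrix n n R) (t : R) :
    V * quadraticPencil M C K t * W =
      quadraticPencil (V * M * W) (V * C * W) (V * K * W) t := by
  simp only [quadraticPencil, mul_add, add_mul, mul_smul_comm, smul_mul_assoc]

lemma mapMatrix_quadraticPencil [Fintype n] [DecidableEq n] (f : R →+* S) (M C K : Matrix n n R)
    (t : R) : f.mapMatrix (quadraticPencil M C K t) =
      quadraticPencil (f.mapMatrix M) (f.mapMatrix C) (f.mapMatrix K) (f t) := by
  ext i j
  simp [quadraticPencil]

lemma submatrix_quadraticPencil {m : Type*} (M C K : Matrix n n R) (t : R) (f g : m → n) :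
    (quadraticPencil M C K t).submatrix f g =
      quadraticPencil (M.submatrix f g) (C.submatrix f g) (K.submatrix f g) t := rfl

lemma quadraticPencil_mul (M C K : Matrix n n R) (a t : R) :
    quadraticPencil M C K (a * t) = quadraticPencil (a ^ 2 • M) (a • C) K t := by
  simp only [quadraticPencil, smul_smul, mul_pow, mul_comm]

lemma smul_quadraticPencil (a : R) (M C K : Matrix n n R) (t : R) :
    a • quadraticPencil M C K t = quadraticPencil (a • M) (a • C) (a • K) t := by
  simp only [quadraticPencil, smul_add, smul_smul, mul_comm]

lemma quadraticPencil_inv {F : Type*} [Field F] (M C K : Matrix n n F) {t : F} (ht : t ≠ 0) :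
    quadraticPencil M C K t⁻¹ = (t ^ 2)⁻¹ • quadraticPencil K C M t := by
  have ht' : (t ^ 2)⁻¹ * t = t⁻¹ := by field_simp
  rw [quadraticPencil, quadraticPencil, smul_add, smul_add, smul_smul, smul_smul, ht', inv_pow,
    inv_mul_cancel₀ (pow_ne_zero 2 ht), one_smul]
  abel

lemma det_quadraticPencil_diagonal [Fintype n] [DecidableEq n] {R : Type*} [CommRing R]
    (d : n → R) (t : R) :
    (quadraticPencil 1 (diagonal d) 0 t).det = ∏ i, t * (t + d i) := by
  have h : quadraticPencil 1 (diagonal d) 0 t = diagonal fun i => t * (t + d i) := by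
    rw [quadraticPencil, add_zero, ← diagonal_one, ← diagonal_smul, ← diagonal_smul,
      diagonal_add]
    congr! 2 with i
    simp only [Pi.smul_apply, smul_eq_mul]
    ring
  rw [h, det_diagonal]

lemma quadraticPencil_smul_diagonal_mul [DecidableEq n] {F : Type*} [Field F]
    (G H : Matrix n n F) (d : n → F) {b : F} (hb : b ≠ 0) (t : F) :
    quadraticPencil 1 (G + b • diagonal d) H (b * t) =
      b ^ 2 • quadraticPencil 1 (b⁻¹ • G + diagonal d) (b⁻¹ ^ 2 • H) t := by
  have hG : b ^ 2 * b⁻¹ = b := by field_simp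
  have hH : b ^ 2 * b⁻¹ ^ 2 = 1 := by field_simp
  rw [quadraticPencil_mul, smul_quadraticPencil, smul_add, smul_add, smul_smul, smul_smul,
    smul_smul, hG, hH, one_smul, sq]

end QuadraticPencil

section Linearization

open Polynomial

variable {n R : Type*} [Fintype n] [DecidableEq n] [CommRing R]

lemma charpoly_fromBlocks_zero₂₂ (T Ψ Φ : Matrix n n R) :
    (fromBlocks T Ψ Φ 0).charpoly =
      (quadraticPencil 1 (-C.mapMatrix T) (-C.mapMatrix (Ψ * Φ)) X).det := by
  refine (isRegular_X_pow (Fintype.card n)).right ?_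
  have h : (fromBlocks T Ψ Φ 0).charmatrix *
      fromBlocks ((X : R[X]) • (1 : Matrix n n R[X])) 0 (C.mapMatrix Φ) 1 =
      fromBlocks (quadraticPencil 1 (-C.mapMatrix T) (-C.mapMatrix (Ψ * Φ)) X)
        (-C.mapMatrix Ψ) 0 ((X : R[X]) • (1 : Matrix n n R[X])) := by
    have hX : scalar n (X : R[X]) = (X : R[X]) • (1 : Matrix n n R[X]) := by
      simp [smul_one_eq_diagonal]
    rw [charmatrix_fromBlocks, fromBlocks_multiply]
    simp only [charmatrix, quadraticPencil, hX, map_mul, map_zero]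
    congr 1
    · simp [sq, smul_smul, sub_eq_add_neg]
    · simp
    · simp
    · simp
  simpa [det_mul, det_fromBlocks_zero₁₂, det_fromBlocks_zero₂₁, charpoly] using congrArg det h

lemma eval_charpoly_fromBlocks_zero₂₂ (T Ψ Φ : Matrix n n R) (z : R) :
    (fromBlocks T Ψ Φ 0).charpoly.eval z = (quadraticPencil 1 (-T) (-(Ψ * Φ)) z).det := by
  have map_C (M : Matrix n n R) : (evalRingHom z).mapMatrix (C.mapMatrix M) = M := by
    ext
    simp
  rw [charpoly_fromBlocks_zero₂₂, ← coe_evalRingHom, RingHom.map_det, mapMatrix_quadraticPencil,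
    map_one, map_neg, map_neg, map_C, map_C, coe_evalRingHom, eval_X]

end Linearization

section Hermitian

variable {n 𝕜 : Type*} [Fintype n] [DecidableEq n] [RCLike 𝕜]

-- The linearization `[[T, Φᴴ], [Φ, 0]]` is Hermitian and invertible.
lemma exists_ofReal_zeros_det_quadraticPencil {T Φ : Matrix n n 𝕜} (hT : T.IsHermitian)
    (hΦ : IsUnit Φ) : ∃ ρ : n ⊕ n → ℝ, (∀ j, ρ j ≠ 0) ∧
      ∀ z : 𝕜, (quadraticPencil 1 (-T) (-(Φᴴ * Φ)) z).det = ∏ j, (z - (ρ j : 𝕜)) := by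
  have hW : (fromBlocks T Φᴴ Φ 0).IsHermitian := by
    simp [IsHermitian, fromBlocks_conjTranspose, hT.eq]
  have hdet (z : 𝕜) : (quadraticPencil 1 (-T) (-(Φᴴ * Φ)) z).det =
      ∏ j, (z - (hW.eigenvalues j : 𝕜)) := by
    rw [← eval_charpoly_fromBlocks_zero₂₂, hW.charpoly_eq, Polynomial.eval_prod]
    simp
  refine ⟨hW.eigenvalues, fun j hj => ?_, hdet⟩
  have hΦdet : Φ.det ≠ 0 := ((isUnit_iff_isUnit_det Φ).mp hΦ).ne_zero
  have h0 : (quadraticPencil 1 (-T) (-(Φᴴ * Φ)) 0).det ≠ 0 := by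
    simp [quadraticPencil, det_neg, det_mul, det_conjTranspose, hΦdet]
  exact h0 ((hdet 0).trans (Finset.prod_eq_zero (Finset.mem_univ j) (by simp [hj])))

lemma exists_simultaneous_diagonalization {K P M : Matrix n n 𝕜} (hP : K * P * Kᴴ = 1)
    (hM : (K * M * Kᴴ).IsHermitian) :
    ∃ V : Matrix n n 𝕜, V * P * Vᴴ = 1 ∧
      V * M * Vᴴ = diagonal (RCLike.ofReal ∘ hM.eigenvalues) := by
  let U : Matrix n n 𝕜 := hM.eigenvectorUnitary.1
  have conj (L : Matrix n n 𝕜) : Uᴴ * K * L * (Uᴴ * K)ᴴ = Uᴴ * (K * L * Kᴴ) * U := by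
    simp only [conjTranspose_mul, conjTranspose_conjTranspose, mul_assoc]
  refine ⟨Uᴴ * K, ?_, ?_⟩
  · rw [conj, hP, mul_one]
    exact Unitary.coe_star_mul_self hM.eigenvectorUnitary
  · rw [conj, ← hM.conjStarAlgAut_star_eigenvectorUnitary, Unitary.conjStarAlgAut_star_apply,
      star_eq_conjTranspose]

end Hermitian

section DetAsymptotics

variable {m n 𝕜 : Type*} [Fintype m] [Fintype n] [DecidableEq m] [DecidableEq n] [NormedField 𝕜]

lemma tendsto_det_fromBlocks_add_smul (G D : Matrix m m 𝕜) (G₁₂ : Matrix m n 𝕜)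
    (G₂₁ : Matrix n m 𝕜) (G₂₂ : Matrix n n 𝕜) :
    Tendsto (fun b : 𝕜 => b⁻¹ ^ Fintype.card m * (fromBlocks (G + b • D) G₁₂ G₂₁ G₂₂).det)
      (Bornology.cobounded 𝕜) (𝓝 (D.det * G₂₂.det)) := by
  have hcont : Continuous fun ε : 𝕜 => (fromBlocks (ε • G + D) (ε • G₁₂) G₂₁ G₂₂).det := by
    fun_prop
  have hlim := (hcont.tendsto 0).comp tendsto_inv₀_cobounded
  rw [zero_smul, zero_smul, zero_add, det_fromBlocks_zero₁₂] at hlim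
  refine hlim.congr' ?_
  filter_upwards [Bornology.eventually_ne_cobounded 0] with b hb
  have hrescale : fromBlocks (b⁻¹ • G + D) (b⁻¹ • G₁₂) G₂₁ G₂₂ =
      fromBlocks (b⁻¹ • (1 : Matrix m m 𝕜)) 0 0 1 * fromBlocks (G + b • D) G₁₂ G₂₁ G₂₂ := by
    simp [fromBlocks_multiply, smul_smul, hb]
  rw [Function.comp_apply, hrescale, det_mul, det_fromBlocks_zero₂₁]
  simp

lemma tendsto_det_add_smul_diagonal (G : Matrix n n 𝕜) {d : n → 𝕜} {p : n → Prop}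
    [DecidablePred p] (hp : ∀ i, ¬ p i → d i = 0) :
    Tendsto (fun b : 𝕜 => b⁻¹ ^ Fintype.card {i // p i} * (G + b • diagonal d).det)
      (Bornology.cobounded 𝕜) (𝓝 ((∏ i : {i // p i}, d i) *
        (G.submatrix (Subtype.val : {i // ¬ p i} → n) Subtype.val).det)) := by
  have hne (i : {i // p i}) (j : {i // ¬ p i}) : (i : n) ≠ j := fun h => j.2 (h ▸ i.2)
  have hblock (b : 𝕜) : (G + b • diagonal d).det =
      (fromBlocks (G.submatrix (Subtype.val : {i // p i} → n) Subtype.val +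
          b • diagonal fun i : {i // p i} => d i)
        (G.submatrix Subtype.val Subtype.val) (G.submatrix Subtype.val Subtype.val)
        (G.submatrix (Subtype.val : {i // ¬ p i} → n) Subtype.val)).det := by
    rw [← det_submatrix_equiv_self (Equiv.sumCompl p)]
    congr 1
    ext (i | i) (j | j)
    · simp [diagonal_apply, Subtype.ext_iff]
    · simp [diagonal_apply_ne d (hne i j)]
    · simp [diagonal_apply_ne' d (hne j i)]
    · simp [diagonal_apply, hp i i.2]
  simp only [hblock, ← det_diagonal (d := fun i : {i // p i} => d i)]
  exact tendsto_det_fromBlocks_add_smul _ _ _ _ _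

end DetAsymptotics

section NonzeroEigenvalues

open Polynomial

lemma filter_ne_zero_roots_X_pow_mul {R : Type*} [CommRing R] [IsDomain R] [DecidableEq R]
    {p : R[X]} (hp : p ≠ 0) (k : ℕ) :
    (X ^ k * p).roots.filter (· ≠ 0) = p.roots.filter (· ≠ 0) := by
  rw [roots_mul (mul_ne_zero (pow_ne_zero k X_ne_zero) hp), roots_X_pow, Multiset.filter_add,
    Multiset.filter_eq_nil.mpr, zero_add]
  intro a ha
  rw [Multiset.mem_nsmul.mp ha |>.2 |> Multiset.mem_singleton.mp]
  simp

variable {F V W : Type*} [Field F] [AddCommGroup V] [AddCommGroup W] [Module F V] [Module F W]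
  [FiniteDimensional F V] [FiniteDimensional F W]

lemma X_pow_finrank_mul_charpoly_comp (f : V →ₗ[F] W) (g : W →ₗ[F] V) :
    X ^ Module.finrank F V * (f ∘ₗ g).charpoly = X ^ Module.finrank F W * (g ∘ₗ f).charpoly := by
  have hV := Module.finBasis F V
  have hW := Module.finBasis F W
  rw [← LinearMap.charpoly_toMatrix (f ∘ₗ g) hW, ← LinearMap.charpoly_toMatrix (g ∘ₗ f) hV,
    LinearMap.toMatrix_comp hW hV hW, LinearMap.toMatrix_comp hV hW hV]
  simpa only [Fintype.card_fin] using
    charpoly_mul_comm' (LinearMap.toMatrix hV hW f) (LinearMap.toMatrix hW hV g)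

lemma filter_ne_zero_roots_charpoly_comp_comm [DecidableEq F] (f : V →ₗ[F] W) (g : W →ₗ[F] V) :
    (f ∘ₗ g).charpoly.roots.filter (· ≠ 0) = (g ∘ₗ f).charpoly.roots.filter (· ≠ 0) := by
  rw [← filter_ne_zero_roots_X_pow_mul (f ∘ₗ g).charpoly_monic.ne_zero,
    X_pow_finrank_mul_charpoly_comp,
    filter_ne_zero_roots_X_pow_mul (g ∘ₗ f).charpoly_monic.ne_zero]

lemma filter_ne_zero_roots_charpoly_compression {𝕜 E : Type*} [RCLike 𝕜] [DecidableEq 𝕜]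
    [NormedAddCommGroup E] [InnerProductSpace 𝕜 E] [FiniteDimensional 𝕜 E] (T : E →ₗ[𝕜] E) :
    (((T.range.orthogonalProjectionOnto : E →ₗ[𝕜] T.range) ∘ₗ T ∘ₗ
      T.range.subtype).charpoly.roots.filter (· ≠ 0)) = T.charpoly.roots.filter (· ≠ 0) := by
  have hcomp : (T.range.orthogonalProjectionOnto : E →ₗ[𝕜] T.range) ∘ₗ T ∘ₗ T.range.subtype =
      T.rangeRestrict ∘ₗ T.range.subtype := by
    ext x
    exact congrArg _ (Submodule.orthogonalProjectionOnto_mem_subspace_eq_self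
      (T.rangeRestrict x))
  rw [hcomp, filter_ne_zero_roots_charpoly_comp_comm, LinearMap.subtype_comp_codRestrict]

lemma charpoly_toEuclideanLin {𝕜 n : Type*} [RCLike 𝕜] [Fintype n] [DecidableEq n]
    (M : Matrix n n 𝕜) : (toEuclideanLin M).charpoly = M.charpoly := by
  rw [toEuclideanLin_eq_toLin_orthonormal, charpoly_toLin]

lemma roots_charpoly_map_ofReal {n : Type*} [Fintype n] [DecidableEq n] {M : Matrix n n ℝ}
    (hM : M.IsHermitian) : (M.map Complex.ofReal).charpoly.roots =
      Finset.univ.val.map fun i => (hM.eigenvalues i : ℂ) := by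
  have h : (M.map Complex.ofReal).charpoly = M.charpoly.map Complex.ofRealHom :=
    charpoly_map M Complex.ofRealHom
  rw [h, hM.splits_charpoly.roots_map, hM.roots_charpoly_eq_eigenvalues, Multiset.map_map]
  rfl

lemma injOn_of_nodup_filter_map {ι Y : Type*} {s : Finset ι} {f : ι → Y} {p : Y → Prop}
    [DecidablePred p] (h : ((s.val.map f).filter p).Nodup) :
    Set.InjOn f {i | i ∈ s ∧ p (f i)} := by
  rw [Multiset.filter_map] at h
  intro i hi j hj hij
  exact Multiset.inj_on_of_nodup_map h i (by simpa using hi) j (by simpa using hj) hij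

end NonzeroEigenvalues

section RealCoefficients

variable {n : Type*} [Fintype n] [DecidableEq n]

/-- A real matrix regarded as a complex one, as a ring homomorphism. -/
abbrev complexMatrix : Matrix n n ℝ →+* Matrix n n ℂ := Complex.ofRealHom.mapMatrix

lemma conjTranspose_complexMatrix (M : Matrix n n ℝ) :
    (complexMatrix M)ᴴ = complexMatrix Mᵀ := by
  ext i j
  simp

lemma exists_ofReal_zeros_of_gyroscopic {G H : Matrix n n ℝ} (hG : Gᵀ = -G) (hH : H.PosDef) :
    ∃ ρ : n ⊕ n → ℝ, (∀ j, ρ j ≠ 0) ∧ ∀ z : ℂ,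
      (quadraticPencil 1 (Complex.I • complexMatrix G) (-complexMatrix H) z).det =
        ∏ j, (z - (ρ j : ℂ)) := by
  obtain ⟨Φ, hΦ, rfl⟩ :=
    CStarAlgebra.isStrictlyPositive_iff_eq_star_mul_self.mp hH.isStrictlyPositive
  have hT : (-(Complex.I • complexMatrix G)).IsHermitian := by
    rw [IsHermitian, conjTranspose_neg, conjTranspose_smul, conjTranspose_complexMatrix, hG,
      map_neg, smul_neg]
    simp
  obtain ⟨ρ, hρ, hdet⟩ := exists_ofReal_zeros_det_quadraticPencil hT (hΦ.map complexMatrix)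
  refine ⟨ρ, hρ, fun z => ?_⟩
  rw [star_eq_conjTranspose, conjTranspose_eq_transpose_of_trivial, map_mul,
    ← conjTranspose_complexMatrix]
  simpa using hdet z

lemma tendsto_det_quadraticPencil_add_smul_diagonal (G H : Matrix n n ℝ) {d : n → ℝ} {p : n → Prop}
    [DecidablePred p] (hp : ∀ i, ¬ p i → d i = 0) (z : ℂ) :
    Tendsto (fun β : ℝ => (β : ℂ)⁻¹ ^ Fintype.card {i // p i} *
        (quadraticPencil 1 (Complex.I • complexMatrix (G + β • diagonal d))
          (-complexMatrix H) z).det) atTop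
      (𝓝 ((∏ i : {i // p i}, z * (Complex.I * d i)) *
        (quadraticPencil 1
          (Complex.I • complexMatrix (G.submatrix (Subtype.val : {i // ¬ p i} → n) Subtype.val))
          (-complexMatrix (H.submatrix (Subtype.val : {i // ¬ p i} → n) Subtype.val))
          z).det)) := by
  have hlim := (tendsto_det_add_smul_diagonal
    (quadraticPencil 1 (Complex.I • complexMatrix G) (-complexMatrix H) z)
    (d := fun i => z * (Complex.I * d i)) (p := p) fun i hi => by simp [hp i hi]).comp
    (RCLike.tendsto_ofReal_atTop_cobounded ℂ)
  rw [submatrix_quadraticPencil, submatrix_one _ Subtype.val_injective] at hlim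
  refine hlim.congr fun β => ?_
  have hsplit : quadraticPencil 1 (Complex.I • complexMatrix (G + β • diagonal d))
        (-complexMatrix H) z =
      quadraticPencil 1 (Complex.I • complexMatrix G) (-complexMatrix H) z +
        (β : ℂ) • diagonal fun i => z * (Complex.I * d i) := by
    ext i j
    by_cases hij : i = j
    · simp [quadraticPencil, hij]
      ring
    · simp [quadraticPencil, hij]
  rw [hsplit]
  rfl

lemma tendsto_det_quadraticPencil_inv_smul (G H : Matrix n n ℝ) (d : n → ℝ) (t : ℝ) :
    Tendsto (fun β : ℝ => (quadraticPencil 1 (β⁻¹ • G + diagonal d) (β⁻¹ ^ 2 • H) t).det) atTop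
      (𝓝 (∏ i, t * (t + d i))) := by
  have hcont : Continuous fun ε : ℝ =>
      (quadraticPencil 1 (ε • G + diagonal d) (ε ^ 2 • H) t).det := by
    unfold quadraticPencil
    fun_prop
  have hlim := (hcont.tendsto 0).comp tendsto_inv_atTop_zero
  simpa [Function.comp_def, det_quadraticPencil_diagonal] using hlim

lemma eventually_exists_zero_near_neg {G H : Matrix n n ℝ} {d : n → ℝ}
    (hd : Set.InjOn d {i | d i ≠ 0}) {i : n} (hi : d i ≠ 0) {U : Set ℝ} (hU : U ∈ 𝓝 (-d i)) :
    ∀ᶠ β : ℝ in atTop, ∃ s ∈ U,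
      (quadraticPencil 1 (β⁻¹ • G + diagonal d) (β⁻¹ ^ 2 • H) s).det = 0 := by
  refine eventually_exists_zero_mem_of_tendsto
    (k := fun t => t * ∏ j ∈ Finset.univ.erase i, t * (t + d j)) (fun β => ?_)
    (tendsto_det_quadraticPencil_inv_smul G H d) (fun t => ?_) ?_ ?_ hU
  · unfold quadraticPencil
    fun_prop
  · rw [← Finset.mul_prod_erase _ _ (Finset.mem_univ i)]
    ring
  · exact Continuous.continuousAt (by fun_prop)
  · refine mul_ne_zero (neg_ne_zero.mpr hi) (Finset.prod_ne_zero_iff.mpr fun j hj => ?_)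
    refine mul_ne_zero (neg_ne_zero.mpr hi) fun h0 => Finset.ne_of_mem_erase hj ?_
    have hij : d j = d i := by linarith
    exact hd (by simpa [hij] using hi) hi hij

lemma eventually_exists_large_zeros_of_injOn (G H : Matrix n n ℝ) {d : n → ℝ}
    (hd : Set.InjOn d {i | d i ≠ 0}) (M : ℝ) :
    ∀ᶠ β : ℝ in atTop, ∃ y : {i // d i ≠ 0} → ℝ, Function.Injective y ∧
      ∀ i, M < |y i| ∧ (quadraticPencil 1 (G + β • diagonal d) H (y i)).det = 0 := by
  have hd' : Function.Injective fun i : {i // d i ≠ 0} => -d i :=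
    fun i j hij => Subtype.ext (hd i.2 j.2 (neg_injective hij))
  have hV (i : {i // d i ≠ 0}) : {s : ℝ | |d i| / 2 < |s|} ∈ 𝓝 (-d i) :=
    (isOpen_lt continuous_const continuous_abs).mem_nhds
      (by simpa using half_lt_self (abs_pos.mpr i.2))
  have hlarge (i : {i // d i ≠ 0}) : ∀ᶠ β : ℝ in atTop, M < β * (|d i| / 2) :=
    (tendsto_id.atTop_mul_const (half_pos (abs_pos.mpr i.2))).eventually_gt_atTop M
  filter_upwards [eventually_exists_injective_mem_of_forall_mem_nhds hd'
      (fun i U hU => eventually_exists_zero_near_neg (G := G) (H := H) hd i.2 hU) hV,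
    eventually_all.mpr hlarge, eventually_gt_atTop 0] with β ⟨s, hs, hsV⟩ hM hβ
  refine ⟨fun i => β * s i, fun i j hij => hs (mul_left_cancel₀ hβ.ne' hij), fun i => ⟨?_, ?_⟩⟩
  · rw [abs_mul, abs_of_pos hβ]
    exact (hM i).trans (mul_lt_mul_of_pos_left (hsV i).1 hβ)
  · rw [quadraticPencil_smul_diagonal_mul G H d hβ.ne', det_smul, (hsV i).2, mul_zero]

end RealCoefficients

section Congruence

variable {n R : Type*} [Fintype n] [CommRing R]

lemma transpose_mul_mul_transpose_of_transpose_eq_neg {G : Matrix n n R} (hG : Gᵀ = -G)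
    (V : Matrix n n R) : (V * G * Vᵀ)ᵀ = -(V * G * Vᵀ) := by
  rw [transpose_mul, transpose_mul, transpose_transpose, hG, neg_mul, mul_neg, mul_assoc]

variable [DecidableEq n]

lemma isUnit_of_mul_mul_eq_one {V P W : Matrix n n R} (h : V * P * W = 1) : IsUnit V :=
  IsUnit.of_mul_eq_one (P * W) (by rw [← mul_assoc, h])

lemma det_mul_mul_mul_det {V P W : Matrix n n R} (h : V * P * W = 1) (M : Matrix n n R) :
    (V * M * W).det * P.det = M.det := by
  have hdet := congrArg det h
  simp only [det_mul, det_one] at hdet ⊢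
  linear_combination M.det * hdet

lemma det_quadraticPencil_mul_det {V P W : Matrix n n R} (h : V * P * W = 1) (C K : Matrix n n R)
    (t : R) : (quadraticPencil 1 (V * C * W) (V * K * W) t).det * P.det =
      (quadraticPencil P C K t).det := by
  rw [← h, ← mul_quadraticPencil_mul, det_mul_mul_mul_det h]

end Congruence

section RealSymmetric

variable {n : Type*} [Fintype n] [DecidableEq n]

lemma transpose_sqrt (M : Matrix n n ℝ) : (CFC.sqrt M)ᵀ = CFC.sqrt M := by
  rw [← conjTranspose_eq_transpose_of_trivial]
  exact (nonneg_iff_posSemidef.mp (CFC.sqrt_nonneg M)).isHermitian.eq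

lemma det_quadraticPencil_complexMatrix_mul_det {V P : Matrix n n ℝ} (h : V * P * Vᵀ = 1)
    (C K : Matrix n n ℝ) (z : ℂ) :
    (quadraticPencil 1 (Complex.I • complexMatrix (V * C * Vᵀ)) (-complexMatrix (V * K * Vᵀ))
      z).det * (complexMatrix P).det =
    (quadraticPencil (complexMatrix P) (Complex.I • complexMatrix C) (-complexMatrix K) z).det := by
  have hc := congrArg complexMatrix h
  simp only [map_mul, map_one] at hc ⊢
  rw [← det_quadraticPencil_mul_det hc, mul_smul_comm, smul_mul_assoc, mul_neg, neg_mul]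

lemma quadraticPencil_complexMatrix_I_mul (P C K : Matrix n n ℝ) (t : ℝ) :
    quadraticPencil (complexMatrix P) (Complex.I • complexMatrix C) (-complexMatrix K)
      (Complex.I * t) = -complexMatrix (quadraticPencil P C K t) := by
  rw [quadraticPencil_mul, Complex.I_sq, smul_smul, Complex.I_mul_I, mapMatrix_quadraticPencil]
  simp only [quadraticPencil, Complex.ofRealHom_eq_coe, neg_smul, one_smul, smul_neg, neg_add]

lemma det_quadraticPencil_complexMatrix_I_mul_eq_zero {P C K : Matrix n n ℝ} {t : ℝ}
    (h : (quadraticPencil P C K t).det = 0) :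
    (quadraticPencil (complexMatrix P) (Complex.I • complexMatrix C) (-complexMatrix K)
      (Complex.I * t)).det = 0 := by
  rw [quadraticPencil_complexMatrix_I_mul, det_neg, ← RingHom.map_det, h, map_zero, mul_zero]

lemma exists_tendsto_det_quadraticPencil_nhds_prod {G H : Matrix n n ℝ} (hG : Gᵀ = -G)
    (hH : H.PosDef) {d : n → ℝ} {k : ℕ} (hk : Fintype.card {i // d i ≠ 0} = k) :
    ∃ K : ℂ, K ≠ 0 ∧ ∃ ρ : {i // ¬ d i ≠ 0} ⊕ {i // ¬ d i ≠ 0} → ℝ, (∀ j, ρ j ≠ 0) ∧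
      ∀ z : ℂ, Tendsto (fun β : ℝ => (β : ℂ)⁻¹ ^ k *
        (quadraticPencil 1 (Complex.I • complexMatrix (G + β • diagonal d)) (-complexMatrix H)
          z).det) atTop (𝓝 (K * (z ^ k * ∏ j, (z - (ρ j : ℂ))))) := by
  subst hk
  obtain ⟨ρ, hρ, hdet⟩ := exists_ofReal_zeros_of_gyroscopic
    (G := G.submatrix (Subtype.val : {i // ¬ d i ≠ 0} → n) Subtype.val)
    (by rw [transpose_submatrix, hG, submatrix_neg]; rfl)
    (hH.submatrix (Subtype.val_injective (p := fun i => ¬ d i ≠ 0)))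
  refine ⟨∏ i : {i // d i ≠ 0}, (Complex.I * d i), ?_, ρ, hρ, fun z => ?_⟩
  · exact Finset.prod_ne_zero_iff.mpr fun i _ =>
      mul_ne_zero Complex.I_ne_zero (Complex.ofReal_ne_zero.mpr i.2)
  have hlim := tendsto_det_quadraticPencil_add_smul_diagonal G H (p := fun i => d i ≠ 0)
    (fun i hi => not_not.mp hi) z
  rwa [hdet, Finset.prod_mul_distrib, Finset.prod_const, Finset.card_univ, mul_assoc,
    mul_left_comm] at hlim

end RealSymmetric

namespace LagrangianSystem

variable {N : ℕ}

lemma Kp_mul_α_mul_transpose (S : LagrangianSystem N) : S.Kp * S.α * S.Kpᵀ = 1 := by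
  have hα : 0 ≤ S.α := nonneg_iff_posSemidef.mpr S.posDef_α.posSemidef
  have hdet : IsUnit (CFC.sqrt S.α).det := by
    rw [← isUnit_iff_isUnit_det, CFC.isUnit_sqrt_iff S.α hα]
    exact S.posDef_α.isUnit
  rw [Kp, transpose_nonsing_inv, transpose_sqrt]
  nth_rw 2 [← CFC.sqrt_mul_sqrt_self S.α hα]
  rw [← mul_assoc, nonsing_inv_mul _ hdet, one_mul, mul_nonsing_inv _ hdet]

lemma Phi_transpose_mul_Phi (S : LagrangianSystem N) :
    S.Phiᵀ * S.Phi = S.Kp * S.η * S.Kpᵀ := by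
  conv_rhs => rw [← CFC.sqrt_mul_sqrt_self S.η (nonneg_iff_posSemidef.mpr S.posSemidef_η)]
  rw [Phi, Kq, transpose_mul, transpose_transpose, transpose_sqrt]
  simp only [mul_assoc]

/-- The nonzero block `K_p R K_pᵀ` of the dissipation operator `B`. -/
def loss (S : LagrangianSystem N) : Matrix (Fin N) (Fin N) ℝ := S.Kp * S.R * S.Kpᵀ

/-- The combined gyroscopic and dissipative coefficient `2θ + βR` of `Q'` in the equation of
motion. -/
def damping (S : LagrangianSystem N) (β : ℝ) : Matrix (Fin N) (Fin N) ℝ :=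
  (2 : ℝ) • S.θ + β • S.R

lemma posSemidef_loss (S : LagrangianSystem N) : S.loss.PosSemidef := by
  have h := S.posSemidef_R.mul_mul_conjTranspose_same S.Kp
  rwa [conjTranspose_eq_transpose_of_trivial] at h

/-- The eigenvalues of the loss matrix `K_p R K_pᵀ`, repeated according to multiplicity. -/
def lossEigenvalues (S : LagrangianSystem N) : Fin N → ℝ :=
  S.posSemidef_loss.isHermitian.eigenvalues

lemma card_lossEigenvalues_ne_zero (S : LagrangianSystem N) :
    Fintype.card {i // S.lossEigenvalues i ≠ 0} = S.NR := by
  have hKp : IsUnit S.Kp.det :=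
    (isUnit_iff_isUnit_det _).mp (isUnit_of_mul_mul_eq_one S.Kp_mul_α_mul_transpose)
  calc Fintype.card {i // S.lossEigenvalues i ≠ 0} = S.loss.rank :=
        S.posSemidef_loss.isHermitian.rank_eq_card_non_zero_eigs.symm
    _ = (S.Kp * S.R).rank :=
        rank_mul_eq_left_of_isUnit_det _ _ (by rwa [det_transpose])
    _ = S.NR := rank_mul_eq_right_of_isUnit_det _ _ hKp

lemma exists_mul_α_eq_one_and_mul_R_eq_diagonal (S : LagrangianSystem N) :
    ∃ V : Matrix (Fin N) (Fin N) ℝ, V * S.α * Vᵀ = 1 ∧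
      V * S.R * Vᵀ = diagonal S.lossEigenvalues := by
  have h := exists_simultaneous_diagonalization (K := S.Kp) (P := S.α) (M := S.R)
    (by rw [conjTranspose_eq_transpose_of_trivial, Kp_mul_α_mul_transpose])
    (by
      rw [conjTranspose_eq_transpose_of_trivial]
      exact S.posSemidef_loss.isHermitian)
  simp only [conjTranspose_eq_transpose_of_trivial] at h
  exact h

lemma Generic.injOn_lossEigenvalues {S : LagrangianSystem N} (hS : S.Generic) :
    Set.InjOn S.lossEigenvalues {i | S.lossEigenvalues i ≠ 0} := by
  have hB : S.B.charpoly.roots.filter (· ≠ 0) =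
      ((Finset.univ : Finset (Fin N)).val.map fun i => (S.lossEigenvalues i : ℂ)).filter
        (· ≠ 0) := by
    rw [B, charpoly_fromBlocks_zero₁₂, charpoly_zero, mul_comm,
      filter_ne_zero_roots_X_pow_mul (charpoly_monic _).ne_zero]
    exact congrArg (Multiset.filter (· ≠ 0))
      (roots_charpoly_map_ofReal S.posSemidef_loss.isHermitian)
  have hB₂ : S.B2.charpoly.roots.filter (· ≠ 0) = S.B.charpoly.roots.filter (· ≠ 0) := by
    rw [← charpoly_toEuclideanLin]
    exact filter_ne_zero_roots_charpoly_compression S.Bop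
  have hinj := injOn_of_nodup_filter_map (hB ▸ hB₂ ▸ hS.filter (· ≠ 0))
  exact fun i hi j hj hij => hinj ⟨Finset.mem_univ i, by simpa using hi⟩
    ⟨Finset.mem_univ j, by simpa using hj⟩ (congrArg Complex.ofReal hij)

lemma A_eq_fromBlocks (S : LagrangianSystem N) (β : ℝ) :
    S.A β = fromBlocks (-(Complex.I • complexMatrix (S.Kp * S.damping β * S.Kpᵀ)))
      (-Complex.I • complexMatrix S.Phiᵀ) (Complex.I • complexMatrix S.Phi) 0 := by
  rw [A, Omega, B, fromBlocks_smul, sub_eq_add_neg, fromBlocks_neg, fromBlocks_add]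
  simp only [smul_zero, neg_zero, add_zero]
  congr 1
  ext i j
  simp [damping, mul_add, add_mul]
  ring

lemma eval_charpoly_A (S : LagrangianSystem N) {V : Matrix (Fin N) (Fin N) ℝ}
    (hV : V * S.α * Vᵀ = 1) (β : ℝ) (z : ℂ) :
    (S.A β).charpoly.eval z = (quadraticPencil 1 (Complex.I • complexMatrix (V * S.damping β * Vᵀ))
      (-complexMatrix (V * S.η * Vᵀ)) z).det := by
  have hα : (complexMatrix S.α).det ≠ 0 := by
    rw [← RingHom.map_det]
    exact Complex.ofReal_ne_zero.mpr S.posDef_α.det_pos.ne'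
  refine mul_right_cancel₀ hα ?_
  rw [det_quadraticPencil_complexMatrix_mul_det hV,
    ← det_quadraticPencil_complexMatrix_mul_det S.Kp_mul_α_mul_transpose, A_eq_fromBlocks,
    eval_charpoly_fromBlocks_zero₂₂, ← Phi_transpose_mul_Phi, map_mul, neg_neg]
  simp [smul_smul]

lemma isRoot_charpoly_A (S : LagrangianSystem N) {β t : ℝ}
    (h : (quadraticPencil S.α (S.damping β) S.η t).det = 0) :
    (S.A β).charpoly.IsRoot (Complex.I * t) := by
  rw [Polynomial.IsRoot, S.eval_charpoly_A S.Kp_mul_α_mul_transpose, ← map_one complexMatrix]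
  refine det_quadraticPencil_complexMatrix_I_mul_eq_zero ?_
  rw [← S.Kp_mul_α_mul_transpose, ← mul_quadraticPencil_mul, det_mul_right_comm, det_mul, h,
    mul_zero]

lemma exists_tendsto_eval_charpoly_A (S : LagrangianSystem N) (hη : S.η.PosDef) :
    ∃ K : ℂ, K ≠ 0 ∧ ∃ ρ : {i // ¬ S.lossEigenvalues i ≠ 0} ⊕
        {i // ¬ S.lossEigenvalues i ≠ 0} → ℝ, (∀ j, ρ j ≠ 0) ∧
      ∀ z : ℂ, Tendsto (fun β : ℝ => (β : ℂ)⁻¹ ^ S.NR * (S.A β).charpoly.eval z) atTop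
        (𝓝 (K * (z ^ S.NR * ∏ j, (z - (ρ j : ℂ))))) := by
  obtain ⟨V, hα, hR⟩ := S.exists_mul_α_eq_one_and_mul_R_eq_diagonal
  have hG : (V * ((2 : ℝ) • S.θ) * Vᵀ)ᵀ = -(V * ((2 : ℝ) • S.θ) * Vᵀ) :=
    transpose_mul_mul_transpose_of_transpose_eq_neg (by rw [transpose_smul, S.skew_θ, smul_neg]) V
  have hH : (V * S.η * Vᵀ).PosDef := by
    have h := (isUnit_of_mul_mul_eq_one hα).posDef_star_right_conjugate_iff.mpr hη
    rwa [star_eq_conjTranspose, conjTranspose_eq_transpose_of_trivial] at h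
  have hdamping (β : ℝ) : V * S.damping β * Vᵀ =
      V * ((2 : ℝ) • S.θ) * Vᵀ + β • diagonal S.lossEigenvalues := by
    rw [damping, mul_add, add_mul, mul_smul_comm β, smul_mul_assoc β, hR]
  simpa only [S.eval_charpoly_A hα, hdamping] using
    exists_tendsto_det_quadraticPencil_nhds_prod hG hH S.card_lossEigenvalues_ne_zero

lemma Generic.eventually_exists_large_zeros {S : LagrangianSystem N} (hS : S.Generic) (M : ℝ) :
    ∀ᶠ β : ℝ in atTop, ∃ y : {i // S.lossEigenvalues i ≠ 0} → ℝ, Function.Injective y ∧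
      ∀ i, M < |y i| ∧ (quadraticPencil S.α (S.damping β) S.η (y i)).det = 0 := by
  obtain ⟨V, hα, hR⟩ := S.exists_mul_α_eq_one_and_mul_R_eq_diagonal
  filter_upwards [eventually_exists_large_zeros_of_injOn (V * ((2 : ℝ) • S.θ) * Vᵀ)
    (V * S.η * Vᵀ) hS.injOn_lossEigenvalues M] with β ⟨y, hy, hzero⟩
  refine ⟨y, hy, fun i => ⟨(hzero i).1, ?_⟩⟩
  rw [← det_quadraticPencil_mul_det hα, damping, mul_add, add_mul, mul_smul_comm β,
    smul_mul_assoc β, hR, (hzero i).2, zero_mul]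

lemma card_roots_charpoly_A (S : LagrangianSystem N) (β : ℝ) :
    (S.A β).charpoly.roots.card = 2 * N := by
  rw [Polynomial.splits_iff_card_roots.mp (IsAlgClosed.splits _), charpoly_natDegree_eq_dim]
  simp [two_mul]

lemma prod_roots_charpoly_A (S : LagrangianSystem N) (β : ℝ) (z : ℂ) :
    ((S.A β).charpoly.roots.map fun a => z - a).prod = (S.A β).charpoly.eval z := by
  conv_rhs => rw [(IsAlgClosed.splits (S.A β).charpoly).eq_prod_roots_of_monic (charpoly_monic _)]
  simp [Polynomial.eval_multiset_prod, Multiset.map_map]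

lemma two_mul_eq_NR_add (S : LagrangianSystem N) :
    2 * N = S.NR + (S.NR + Fintype.card
      ({i // ¬ S.lossEigenvalues i ≠ 0} ⊕ {i // ¬ S.lossEigenvalues i ≠ 0})) := by
  have hN := Fintype.card_congr (Equiv.sumCompl fun i => S.lossEigenvalues i ≠ 0)
  rw [Fintype.card_sum, Fintype.card_fin, card_lossEigenvalues_ne_zero] at hN
  rw [Fintype.card_sum]
  omega

lemma exists_isModalEnumeration (S : LagrangianSystem N) (hη : S.η.PosDef) :
    ∃ ζ : Fin (2 * N) → ℝ → ℂ, S.IsModalEnumeration ζ := by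
  obtain ⟨K, hK, ρ, hρ, hlim⟩ := S.exists_tendsto_eval_charpoly_A hη
  obtain ⟨r, hr_zero, hr_range, hr_prod⟩ :=
    exists_fin_family_prod_filter_eq (M := ℂ) S.two_mul_eq_NR_add 0 ρ
  obtain ⟨ζ, hroots, hlow, hhigh⟩ := exists_enumeration_of_tendsto
    (s := fun β => (S.A β).charpoly.roots) (c := fun β : ℝ => (β : ℂ)⁻¹ ^ S.NR)
    (J := Finset.univ.filter fun j : Fin (2 * N) => S.NR ≤ (j : ℕ)) (Finset.subset_univ _)
    (fun β => by rw [card_roots_charpoly_A, Finset.card_fin]) (fun j => (r j : ℂ)) hK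
    (Eventually.of_forall fun z => by
      simpa only [prod_roots_charpoly_A, hr_prod fun a : ℝ => z - (a : ℂ), Complex.ofReal_zero,
        sub_zero] using hlim z)
  refine ⟨ζ, Eventually.of_forall hroots, fun j hj => ?_, fun j hj hj' => ?_, fun j hj => ?_⟩
  · exact tendsto_norm_atTop_iff_cobounded.mpr (hhigh j (Finset.mem_univ j) (by simpa using hj))
  · simpa [hr_zero j hj'] using hlow j (by simpa using hj)
  · obtain ⟨c, hc⟩ := hr_range j hj
    have hj' : S.NR ≤ (j : ℕ) := by omega
    exact ⟨r j, hc ▸ hρ c, hlow j (by simpa using hj')⟩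

namespace IsModalEnumeration

variable {S : LagrangianSystem N} {ζ : Fin (2 * N) → ℝ → ℂ}

lemma eventually_exists_eq_of_isRoot (hζ : S.IsModalEnumeration ζ) :
    ∀ᶠ β : ℝ in atTop, ∀ z, (S.A β).charpoly.IsRoot z → ∃ j, ζ j β = z := by
  filter_upwards [hζ.eigenvalues] with β hroots z hz
  have hmem := (Polynomial.mem_roots (charpoly_monic (S.A β)).ne_zero).mpr hz
  rw [hroots] at hmem
  simpa using hmem

-- As `J` has at most as many elements as there are imaginary eigenvalues `i y` in `U`, the
-- eigenvalues indexed by `J` must be exactly these.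
lemma eventually_re_eq_zero {ι : Type*} [Fintype ι] (hζ : S.IsModalEnumeration ζ)
    {J : Finset (Fin (2 * N))} (hJ : J.card ≤ Fintype.card ι) {U : Set ℂ}
    (hU : ∀ j, j ∉ J → ∀ᶠ β in atTop, ζ j β ∉ U)
    (hy : ∀ᶠ β : ℝ in atTop, ∃ y : ι → ℝ, Function.Injective y ∧ ∀ i, Complex.I * y i ∈ U ∧
      (quadraticPencil S.α (S.damping β) S.η (y i)).det = 0) :
    ∀ᶠ β : ℝ in atTop, ∀ j ∈ J, (ζ j β).re = 0 := by
  have hU' : ∀ᶠ β in atTop, ∀ j, j ∉ J → ζ j β ∉ U :=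
    eventually_all.mpr fun j => eventually_imp_distrib_left.mpr (hU j)
  filter_upwards [hζ.eventually_exists_eq_of_isRoot, hU', hy]
    with β hroot hU ⟨y, hy_inj, hy⟩ j hj
  have hmem (i : ι) : ∃ j ∈ J, ζ j β = Complex.I * y i := by
    obtain ⟨j, hj⟩ := hroot _ (S.isRoot_charpoly_A (hy i).2)
    exact ⟨j, by_contra fun hjJ => hU j hjJ (hj ▸ (hy i).1), hj⟩
  have hinj : Function.Injective fun i => Complex.I * (y i : ℂ) :=
    (mul_right_injective₀ Complex.I_ne_zero).comp (Complex.ofReal_injective.comp hy_inj)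
  obtain ⟨i, hi⟩ := mem_range_of_injective_of_card_le hinj hJ hmem hj
  simp [← hi]

lemma exists_tendsto_of_le (hζ : S.IsModalEnumeration ζ) {j : Fin (2 * N)}
    (hj : S.NR ≤ (j : ℕ)) : ∃ a, Tendsto (ζ j) atTop (𝓝 a) := by
  by_cases hj' : (j : ℕ) < 2 * S.NR
  · exact ⟨0, hζ.low_loss_low_Q j hj hj'⟩
  · obtain ⟨ρ, -, hρ⟩ := hζ.low_loss_high_Q j (not_lt.mp hj')
    exact ⟨ρ, hρ⟩

lemma exists_tendsto_inv (hζ : S.IsModalEnumeration ζ) {j : Fin (2 * N)}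
    (hj : (j : ℕ) < S.NR ∨ 2 * S.NR ≤ (j : ℕ)) : ∃ a, Tendsto (fun β => (ζ j β)⁻¹) atTop (𝓝 a) := by
  rcases hj with hj | hj
  · exact ⟨0, tendsto_inv₀_cobounded.comp
      (tendsto_norm_atTop_iff_cobounded.mp (hζ.high_loss j hj))⟩
  · obtain ⟨ρ, hρ, hlim⟩ := hζ.low_loss_high_Q j hj
    exact ⟨_, hlim.inv₀ (Complex.ofReal_ne_zero.mpr hρ)⟩

lemma eventually_re_eq_zero_of_high_loss (hζ : S.IsModalEnumeration ζ) (hS : S.Generic) :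
    ∀ᶠ β : ℝ in atTop, ∀ j : Fin (2 * N), (j : ℕ) < S.NR → (ζ j β).re = 0 := by
  obtain ⟨M, hM⟩ := exists_forall_eventually_norm_le fun j => hζ.exists_tendsto_of_le (j := j)
  have hJ : (Finset.univ.filter fun j : Fin (2 * N) => (j : ℕ) < S.NR).card ≤
      Fintype.card {i // S.lossEigenvalues i ≠ 0} := by
    rw [card_lossEigenvalues_ne_zero, Fin.card_filter_val_lt]
    exact min_le_right _ _
  have hre := hζ.eventually_re_eq_zero (U := {z | M < ‖z‖}) hJ
    (fun j hj => (hM j (by simpa using hj)).mono fun β => not_lt.mpr)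
    (by simpa using hS.eventually_exists_large_zeros M)
  simpa using hre

lemma eventually_re_eq_zero_of_low_Q (hζ : S.IsModalEnumeration ζ) (hη : S.η.PosDef)
    (hS : (S.dual hη).Generic) :
    ∀ᶠ β : ℝ in atTop, ∀ j : Fin (2 * N), S.NR ≤ (j : ℕ) → (j : ℕ) < 2 * S.NR →
      (ζ j β).re = 0 := by
  obtain ⟨M, hM⟩ := exists_forall_eventually_norm_le fun j => hζ.exists_tendsto_inv (j := j)
  have hJ : (Finset.univ.filter fun j : Fin (2 * N) =>
      S.NR ≤ (j : ℕ) ∧ (j : ℕ) < 2 * S.NR).card ≤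
      Fintype.card {i // (S.dual hη).lossEigenvalues i ≠ 0} := by
    calc (Finset.univ.filter fun j : Fin (2 * N) => S.NR ≤ (j : ℕ) ∧ (j : ℕ) < 2 * S.NR).card
      _ ≤ (Finset.Ico S.NR (2 * S.NR)).card :=
          Finset.card_le_card_of_injOn Fin.val (fun j hj => by simpa using hj)
            Fin.val_injective.injOn
      _ = S.NR := by rw [Nat.card_Ico, two_mul, Nat.add_sub_cancel]
      _ = _ := (S.dual hη).card_lossEigenvalues_ne_zero.symm
  have hy : ∀ᶠ β : ℝ in atTop, ∃ y : {i // (S.dual hη).lossEigenvalues i ≠ 0} → ℝ,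
      Function.Injective y ∧ ∀ i, Complex.I * y i ∈ {z : ℂ | M < ‖z⁻¹‖} ∧
        (quadraticPencil S.α (S.damping β) S.η (y i)).det = 0 := by
    filter_upwards [hS.eventually_exists_large_zeros (max M 0)] with β ⟨y, hy_inj, hy⟩
    refine ⟨fun i => (y i)⁻¹, inv_injective.comp hy_inj, fun i => ⟨?_, ?_⟩⟩
    · simpa using (le_max_left M 0).trans_lt (hy i).1
    · have hyi : y i ≠ 0 := abs_pos.mp ((le_max_right M 0).trans_lt (hy i).1)
      have hzero : (quadraticPencil S.η (S.damping β) S.α (y i)).det = 0 := (hy i).2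
      rw [quadraticPencil_inv _ _ _ hyi, det_smul, hzero, mul_zero]
  have hre := hζ.eventually_re_eq_zero hJ
    (fun j hj => (hM j (by simp only [Finset.mem_filter_univ] at hj; omega)).mono
      fun β => not_lt.mpr) hy
  simpa using hre

lemma tendsto_re_of_low_Q (hζ : S.IsModalEnumeration ζ) {j : Fin (2 * N)} (hj : S.NR ≤ (j : ℕ))
    (hj' : (j : ℕ) < 2 * S.NR) : Tendsto (fun β => (ζ j β).re) atTop (𝓝 0) := by
  simpa [Function.comp_def] using
    (Complex.continuous_re.tendsto 0).comp (hζ.low_loss_low_Q j hj hj')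

lemma eventually_re_ne_zero_of_high_Q (hζ : S.IsModalEnumeration ζ) :
    ∀ᶠ β : ℝ in atTop, ∀ j : Fin (2 * N), 2 * S.NR ≤ (j : ℕ) → (ζ j β).re ≠ 0 := by
  refine eventually_all.mpr fun j => eventually_imp_distrib_left.mpr fun hj => ?_
  obtain ⟨ρ, hρ, hlim⟩ := hζ.low_loss_high_Q j hj
  exact ((Complex.continuous_re.tendsto ρ).comp hlim).eventually_ne hρ

end IsModalEnumeration

end LagrangianSystem

theorem mainTheorem2 {N : ℕ} (S : LagrangianSystem N) (hη : S.η.PosDef)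
    (hgen : S.Generic) (hgen_dual : (S.dual hη).Generic) :
    (∃ ζ : Fin (2 * N) → ℝ → ℂ, S.IsModalEnumeration ζ) ∧
    ∀ ζ : Fin (2 * N) → ℝ → ℂ, S.IsModalEnumeration ζ →
      (∀ᶠ β : ℝ in atTop, ∀ j : Fin (2 * N), (j : ℕ) < S.NR → (ζ j β).re = 0) ∧
      (∀ᶠ β : ℝ in atTop, ∀ j : Fin (2 * N), 2 * S.NR ≤ (j : ℕ) → (ζ j β).re ≠ 0) ∧
      (∀ j : Fin (2 * N), S.NR ≤ (j : ℕ) → (j : ℕ) < 2 * S.NR →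
        Tendsto (fun β => (ζ j β).re) atTop (𝓝 0)) ∧
      (∀ᶠ β : ℝ in atTop, ∀ j : Fin (2 * N), S.NR ≤ (j : ℕ) → (j : ℕ) < 2 * S.NR →
        (ζ j β).re = 0) :=
  ⟨S.exists_isModalEnumeration hη, fun _ hζ =>
    ⟨hζ.eventually_re_eq_zero_of_high_loss hgen, hζ.eventually_re_ne_zero_of_high_Q,
      fun _ => hζ.tendsto_re_of_low_Q, hζ.eventually_re_eq_zero_of_low_Q hη hgen_dual⟩⟩

end
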